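/- Let $n\ge 0$ and let $G$ be a simple graph with vertex set $[n]=\{1,\dots,n\}$. All algebras are associative, unital and over $\mathbf Q$. The Fomin–Kirillov algebra $\mathcal E_n$ is generated by symbols $x_{ij}$ ($i\neq j$ in $[n]$) subject to the relations $x_{ij}=-x_{ji}$; $x_{ij}^2=0$ for distinct $i,j$; $x_{ij}x_{kl}=x_{kl}x_{ij}$ for distinct $i,j,k,l$; and $x_{ij}x_{jk}+x_{jk}x_{ki}+x_{ki}x_{ij}=0$ for distinct $i,j,k$. Let $\mathcal E_G\subseteq\mathcal E_n$ be the subalgebra generated by the $x_{ij}$ with $\overline{ij}$ an edge of $G$, and let $\pi\colon\mathcal E_G\to\mathcal E_G^{ab}$ be its commutative quotient, i.e. the quotient by the two-sided ideal generated by the elements $x_{ij}x_{ik}-x_{ik}x_{ij}$ with $\overline{ij},\overline{ik}$ edges of $G$. The (Artinian) Orlik–Terao algebra $U_G$ of the graphical arrangement of $G$ is the commutative algebra generated by symbols $u_{ij}=-u_{ji}$, for the edges $\overline{ij}$ of $G$, subject to the following relations, where $k\ge 0$ and $\overline{i_1j_1},\dots,\overline{i_kj_k}$ are any edges of $G$: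 - $\prod_{p=1}^k u_{i_pj_p}=0$ if an edge is repeated among the $\overline{i_pj_p}$, or if the graph formed by these edges contains a cycle; - $\sum_{p=1}^k c_p\prod_{q\ne p}u_{i_qj_q}=0$ whenever $c_1,\dots,c_k\in\mathbf Q$ satisfy $\sum_{p=1}^k c_p\,(e_{i_p}-e_{j_p})=0$, where $e_1,\dots,e_n$ is the standard basis of $\mathbf Q^n$. **Theorem.** The commutative quotient $\mathcal E_G^{ab}$ and the Orlik–Terao algebra $U_G$ are isomorphic as $\mathbf Q$-algebras, by an isomorphism that sends $\pi(x_{ij})$ to $u_{ij}$ for every edge $\overline{ij}$ of $G$. -/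

import Mathlib

/-- The ordered pairs of distinct elements of `[n]`; they index the symbols `x i j`. -/
abbrev OrdPair (n : ℕ) : Type := {p : Fin n × Fin n // p.1 ≠ p.2}

/-- The symbol `x i j` in the free noncommutative algebra. -/
noncomputable def freeX {n : ℕ} (i j : Fin n) (h : i ≠ j) : FreeAlgebra ℚ (OrdPair n) :=
  FreeAlgebra.ι ℚ ⟨(i, j), h⟩

/-- The defining relations of the Fomin-Kirillov algebra on the vertices `[n]`. -/
inductive FKRel (n : ℕ) : FreeAlgebra ℚ (OrdPair n) → FreeAlgebra ℚ (OrdPair n) → Prop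
  | antisymm (i j : Fin n) (h : i ≠ j) : FKRel n (freeX i j h) (-freeX j i h.symm)
  | sq (i j : Fin n) (h : i ≠ j) : FKRel n (freeX i j h ^ 2) 0
  | comm (i j k l : Fin n) (hij : i ≠ j) (hkl : k ≠ l)
      (_hik : i ≠ k) (_hil : i ≠ l) (_hjk : j ≠ k) (_hjl : j ≠ l) :
      FKRel n (freeX i j hij * freeX k l hkl) (freeX k l hkl * freeX i j hij)
  | triangle (i j k : Fin n) (hij : i ≠ j) (hjk : j ≠ k) (hki : k ≠ i) :
      FKRel n (freeX i j hij * freeX j k hjk + freeX j k hjk * freeX k i hki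
        + freeX k i hki * freeX i j hij) 0

/-- The Fomin-Kirillov algebra on the vertices `[n]`: the quotient of the free `ℚ`-algebra by the
two-sided ideal generated by the relations above. -/
abbrev FKAlg (n : ℕ) : Type := RingQuot (FKRel n)

/-- The generator `x i j` of the Fomin-Kirillov algebra. -/
noncomputable def fkX {n : ℕ} (i j : Fin n) (h : i ≠ j) : FKAlg n :=
  RingQuot.mkAlgHom ℚ (FKRel n) (freeX i j h)

/-- The Fomin-Kirillov algebra of a graph `G` on `[n]`: the (unital) subalgebra generated by the
`x i j` for the edges `ij` of `G`. A `G.Dart` is an edge of `G` with an orientation. -/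
noncomputable abbrev FKSub {n : ℕ} (G : SimpleGraph (Fin n)) : Subalgebra ℚ (FKAlg n) :=
  Algebra.adjoin ℚ (Set.range fun d : G.Dart => fkX d.fst d.snd d.adj.ne)

/-- The generator `x i j`, for an edge `ij` of `G`, as an element of the subalgebra. -/
noncomputable def edgeX {n : ℕ} (G : SimpleGraph (Fin n)) (i j : Fin n) (h : G.Adj i j) : FKSub G :=
  ⟨fkX i j h.ne, Algebra.subset_adjoin ⟨⟨(i, j), h⟩, rfl⟩⟩

/-- Generators of two edges of `G` with a common endpoint are to commute. -/
inductive AbRel {n : ℕ} (G : SimpleGraph (Fin n)) : FKSub G → FKSub G → Prop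
  | comm (i j k : Fin n) (hij : G.Adj i j) (hik : G.Adj i k) :
      AbRel G (edgeX G i j hij * edgeX G i k hik) (edgeX G i k hik * edgeX G i j hij)

/-- The commutative quotient of the Fomin-Kirillov algebra of `G`: the quotient by the two-sided
ideal generated by all `x i j * x i k - x i k * x i j` with `ij` and `ik` edges of `G`. -/
abbrev FKAb {n : ℕ} (G : SimpleGraph (Fin n)) : Type := RingQuot (AbRel G)

/-- The quotient map onto the commutative quotient. -/
noncomputable def abProj {n : ℕ} (G : SimpleGraph (Fin n)) : FKSub G →ₐ[ℚ] FKAb G :=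
  RingQuot.mkAlgHom ℚ (AbRel G)

/-- The graph on `[n]` whose edges are those of the oriented edges `d 0, …, d (k - 1)`. -/
def suppGraph {n k : ℕ} {G : SimpleGraph (Fin n)} (d : Fin k → G.Dart) : SimpleGraph (Fin n) :=
  SimpleGraph.fromEdgeSet (Set.range fun p => (d p).edge)

/-- The vector `e_i - e_j` attached to an oriented edge `(i, j)`. -/
def edgeVec {n : ℕ} {G : SimpleGraph (Fin n)} (d : G.Dart) : Fin n → ℚ :=
  Pi.single d.fst 1 - Pi.single d.snd 1

/-- The defining relators of the Orlik-Terao algebra of `G`, in the commutative polynomial ring on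
the symbols `u i j`, one for each oriented edge `(i, j)` of `G`. -/
inductive OTRelator {n : ℕ} (G : SimpleGraph (Fin n)) : MvPolynomial G.Dart ℚ → Prop
  | antisymm (d : G.Dart) : OTRelator G (MvPolynomial.X d + MvPolynomial.X d.symm)
  /-- a monomial with a repeated variable (up to sign) vanishes -/
  | repeated (k : ℕ) (d : Fin k → G.Dart) (p q : Fin k) (_hpq : p ≠ q)
      (_h : (d p).edge = (d q).edge) : OTRelator G (∏ r, MvPolynomial.X (d r))
  /-- a monomial whose support contains a cycle vanishes -/
  | cycle (k : ℕ) (d : Fin k → G.Dart) (_h : ¬ (suppGraph d).IsAcyclic) :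
      OTRelator G (∏ r, MvPolynomial.X (d r))
  /-- the relation given by a linear dependence of the vectors `e_i - e_j` -/
  | dependence (k : ℕ) (d : Fin k → G.Dart) (c : Fin k → ℚ) (_h : ∑ p, c p • edgeVec (d p) = 0) :
      OTRelator G (∑ p, c p • ∏ q ∈ Finset.univ.erase p, MvPolynomial.X (d q))

/-- The (Artinian) Orlik-Terao algebra of the graphical arrangement of `G`. -/
abbrev OTAlg {n : ℕ} (G : SimpleGraph (Fin n)) : Type :=
  MvPolynomial G.Dart ℚ ⧸ Ideal.span {f | OTRelator G f}

/-- The generator `u i j` of the Orlik-Terao algebra, for an edge `ij` of `G`. -/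
noncomputable def otU {n : ℕ} (G : SimpleGraph (Fin n)) (i j : Fin n) (h : G.Adj i j) : OTAlg G :=
  Ideal.Quotient.mk (Ideal.span {f | OTRelator G f}) (MvPolynomial.X ⟨(i, j), h⟩)

/-- The generators of the subalgebra commute with each other in the commutative quotient. -/
theorem abProj_edgeX_comm {n : ℕ} (G : SimpleGraph (Fin n)) (i j k l : Fin n)
    (h : G.Adj i j) (h' : G.Adj k l) :
    abProj G (edgeX G i j h) * abProj G (edgeX G k l h') =
      abProj G (edgeX G k l h') * abProj G (edgeX G i j h) := by
  have anti : ∀ (a b : Fin n) (e : G.Adj a b), edgeX G a b e = -edgeX G b a e.symm := by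
    intro a b e
    apply Subtype.ext
    have := RingQuot.mkAlgHom_rel ℚ (FKRel.antisymm a b e.ne)
    simpa [edgeX, fkX] using this
  have neg : ∀ x : FKSub G, abProj G (-x) = (-1 : ℚ) • abProj G x := by
    intro x
    have e : -x = (-1 : ℚ) • x := Subtype.ext (neg_one_smul ℚ (x : FKAlg n)).symm
    rw [e, map_smul]
  have key : ∀ (a b c : Fin n) (e : G.Adj a b) (e' : G.Adj a c),
      abProj G (edgeX G a b e) * abProj G (edgeX G a c e') =
        abProj G (edgeX G a c e') * abProj G (edgeX G a b e) := by
    intro a b c e e'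
    have := RingQuot.mkAlgHom_rel ℚ (AbRel.comm (G := G) a b c e e')
    simpa only [abProj, map_mul] using this
  by_cases h1 : i = k
  · subst h1; exact key _ _ _ _ _
  by_cases h2 : i = l
  · subst h2
    rw [anti k i h', neg, mul_smul_comm, smul_mul_assoc, key _ _ _ _ _]
  by_cases h3 : j = k
  · subst h3
    rw [anti i j h, neg, mul_smul_comm, smul_mul_assoc, key _ _ _ _ _]
  by_cases h4 : j = l
  · subst h4
    rw [anti i j h, anti k j h', neg, neg, smul_mul_smul_comm, smul_mul_smul_comm, key _ _ _ _ _]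
  · rw [← map_mul, ← map_mul]
    congr 1
    apply Subtype.ext
    have := RingQuot.mkAlgHom_rel ℚ (FKRel.comm i j k l h.ne h'.ne h1 h2 h3 h4)
    rw [map_mul, map_mul] at this
    exact this

/-- The quotient is commutative, so it is the abelianization (the relators are commutators). -/
theorem fkAb_mul_comm {n : ℕ} (G : SimpleGraph (Fin n)) (a b : FKAb G) : a * b = b * a := by
  have surj : Function.Surjective (abProj G) := RingQuot.mkAlgHom_surjective ℚ (AbRel G)
  obtain ⟨a, rfl⟩ := surj a
  obtain ⟨b, rfl⟩ := surj b
  obtain ⟨a, ha⟩ := a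
  obtain ⟨b, hb⟩ := b
  induction ha, hb using Algebra.adjoin_induction₂ with
  | mem_mem x y hx hy =>
    obtain ⟨d, rfl⟩ := hx
    obtain ⟨e, rfl⟩ := hy
    exact abProj_edgeX_comm G d.fst d.snd e.fst e.snd d.adj e.adj
  | algebraMap_both r s =>
    exact ((show Commute (algebraMap ℚ (FKSub G) r) _ from
      Algebra.commutes r (algebraMap ℚ (FKSub G) s)).map (abProj G)).eq
  | algebraMap_left r x hx =>
    exact (show Commute (algebraMap ℚ (FKSub G) r) _ from
      Algebra.commutes r ⟨x, _⟩).map (abProj G) |>.eq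
  | algebraMap_right r x hx =>
    exact ((show Commute (algebraMap ℚ (FKSub G) r) _ from
      Algebra.commutes r ⟨x, _⟩).map (abProj G)).eq.symm
  | add_left x y z hx hy hz h1 h2 =>
    have e : (⟨x + y, add_mem hx hy⟩ : FKSub G) = ⟨x, hx⟩ + ⟨y, hy⟩ := rfl
    rw [e, map_add, add_mul, mul_add, h1, h2]
  | add_right x y z hx hy hz h1 h2 =>
    have e : (⟨y + z, add_mem hy hz⟩ : FKSub G) = ⟨y, hy⟩ + ⟨z, hz⟩ := rfl
    rw [e, map_add, add_mul, mul_add, h1, h2]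
  | mul_left x y z hx hy hz h1 h2 =>
    have e : (⟨x * y, mul_mem hx hy⟩ : FKSub G) = ⟨x, hx⟩ * ⟨y, hy⟩ := rfl
    rw [e, map_mul, mul_assoc, h2, ← mul_assoc, h1, mul_assoc]
  | mul_right x y z hx hy hz h1 h2 =>
    have e : (⟨y * z, mul_mem hy hz⟩ : FKSub G) = ⟨y, hy⟩ * ⟨z, hz⟩ := rfl
    rw [e, map_mul, ← mul_assoc, h1, mul_assoc, h2, ← mul_assoc]

-- The Fomin–Kirillov algebra of `G` is a subalgebra without a presentation, so the map is built
-- from the presented side, ψ : `OTAlg G` → `FKAb G`. The triangle relation gives by induction one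
-- relation for each cycle (`walkProd_eq_walkRot`). Its commutative image is the Orlik–Terao
-- relation of that circuit, and circuits generate all dependences (`IsCyclicSystem.sum_eq_zero`).
-- So ψ is well defined, and it hits the generators.
--
-- For injectivity, the full algebra on `[n]` acts by commuting operators F ↦ F(S ∪ {d}) (zero if d
-- ∈ S) on the functions of sets of pairs that satisfy the Orlik–Terao relations
-- (`exists_fk_action`); the restriction to the subalgebra of `G` descends to `FKAb G`. One such
-- function is `complProd`, a common multiple of the inverse products 1/∏ v_s. Acting on it and
-- evaluating at ∅ turns a kernel element Σ a_S u_S into a linear relation between complementary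
-- products. By deletion and contraction, such a relation holds for every function with the
-- Orlik–Terao relations (`IsOrlikTerao.sum_eq_zero`), in particular for S ↦ u_S, so the element is
-- zero.

universe u

/-! ### Orlik–Terao functions of a vector configuration; deletion and contraction. -/

section VectorConfigurations

variable {K : Type*} [Field K] {ι : Type*} [DecidableEq ι]

/-- A function on the subsets of `A` that kills the linearly dependent subsets and satisfies the
Orlik-Terao relation attached to each linear dependence. -/
structure IsOrlikTerao (K : Type*) [Field K] {ι : Type*} [DecidableEq ι] {V : Type*}
    [AddCommGroup V] [Module K V] (v : ι → V) (A : Finset ι) {M : Type*} [AddCommGroup M]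
    [Module K M] (F : Finset ι → M) : Prop where
  dep : ∀ S ⊆ A, ¬ LinearIndepOn K v (S : Set ι) → F S = 0
  rel : ∀ T ⊆ A, ∀ c : ι → K, ∑ t ∈ T, c t • v t = 0 → ∑ t ∈ T, c t • F (T.erase t) = 0

open Classical in
/-- The product of the vectors outside of an independent subset `S` of `A`, in the symmetric
algebra. This is the product of `A` times the product of the inverses of `S`. -/
noncomputable def complProd (K : Type*) [Field K] {ι : Type*} [DecidableEq ι] {V : Type*}
    [AddCommGroup V] [Module K V] (v : ι → V) (A S : Finset ι) : SymmetricAlgebra K V :=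
  if LinearIndepOn K v (S : Set ι) then ∏ t ∈ A \ S, SymmetricAlgebra.ι K V (v t) else 0

variable {V : Type*} [AddCommGroup V] [Module K V]

theorem complProd_of_indep {v : ι → V} {S : Finset ι} (h : LinearIndepOn K v (S : Set ι))
    (A : Finset ι) : complProd K v A S = ∏ t ∈ A \ S, SymmetricAlgebra.ι K V (v t) :=
  if_pos h

theorem complProd_of_dep {v : ι → V} {S : Finset ι} (h : ¬ LinearIndepOn K v (S : Set ι))
    (A : Finset ι) : complProd K v A S = 0 :=
  if_neg h

/-- If `T.erase p` is independent, the dependences on `T` form a line spanned by `c`; one that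
vanishes at `q` is zero because `c q ≠ 0`. -/
theorem linearIndepOn_erase_of_dependence {v : ι → V} {T : Finset ι} {c : ι → K}
    (hc : ∑ t ∈ T, c t • v t = 0) {p q : ι} (hp : p ∈ T) (hq : q ∈ T) (hcq : c q ≠ 0)
    (h : LinearIndepOn K v (T.erase p : Set ι)) : LinearIndepOn K v (T.erase q : Set ι) := by
  rw [linearIndepOn_finset_iff] at h ⊢
  by_cases hpq : p = q
  · subst hpq; exact h
  intro f hf
  have hcp : c p ≠ 0 := by
    intro h0
    rw [← Finset.add_sum_erase _ _ hp, h0, zero_smul, zero_add] at hc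
    exact hcq (h c hc q (Finset.mem_erase.2 ⟨Ne.symm hpq, hq⟩))
  have hf' : ∑ t ∈ T, (if t = q then 0 else f t) • v t = 0 := by
    rw [← Finset.add_sum_erase _ _ hq, if_pos rfl, zero_smul, zero_add, ← hf]
    exact Finset.sum_congr rfl fun t ht => by rw [if_neg (Finset.ne_of_mem_erase ht)]
  have hg : ∑ t ∈ T.erase p, (f p * c t - c p * (if t = q then 0 else f t)) • v t = 0 := by
    have h1 : ∑ t ∈ T, (f p * c t - c p * (if t = q then 0 else f t)) • v t = 0 := by
      simp only [sub_smul, mul_smul, Finset.sum_sub_distrib, ← Finset.smul_sum, hc, hf', smul_zero,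
        sub_zero]
    rw [← Finset.add_sum_erase _ _ hp, if_neg hpq] at h1
    rw [mul_comm (f p) (c p), sub_self, zero_smul, zero_add] at h1
    exact h1
  have hfp : f p = 0 := by
    have := h _ hg q (Finset.mem_erase.2 ⟨Ne.symm hpq, hq⟩)
    simpa [hcq] using this
  intro t ht
  rw [Finset.mem_erase] at ht
  by_cases htp : t = p
  · rw [htp, hfp]
  · have := h _ hg t (Finset.mem_erase.2 ⟨htp, ht.2⟩)
    simpa [hfp, hcp, ht.1] using this

/-- Every term of a relation is the product over `A \ T` times `c t • v t`, so the sum contains the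
factor `∑ c t • v t = 0`. The exchange lemma ensures that no term with `c t ≠ 0` is replaced by
zero, unless all are. -/
theorem isOrlikTerao_complProd (v : ι → V) (A : Finset ι) :
    IsOrlikTerao K v A (complProd K v A) where
  dep _ _ h := complProd_of_dep h A
  rel T hT c hc := by
    by_cases h : ∃ p ∈ T, LinearIndepOn K v (T.erase p : Set ι)
    · obtain ⟨p, hp, hi⟩ := h
      have key : ∀ t ∈ T, c t • complProd K v A (T.erase t) =
          (∏ s ∈ A \ T, SymmetricAlgebra.ι K V (v s)) * SymmetricAlgebra.ι K V (c t • v t) := by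
        intro t ht
        by_cases h0 : c t = 0
        · simp [h0]
        have hA : A \ T.erase t = insert t (A \ T) := by
          ext s
          simp only [Finset.mem_sdiff, Finset.mem_erase, Finset.mem_insert]
          by_cases hs : s = t
          · subst hs; simp [hT ht]
          · simp [hs]
        rw [complProd_of_indep (linearIndepOn_erase_of_dependence hc hp ht h0 hi), hA,
          Finset.prod_insert (by simp [ht]), map_smul, mul_smul_comm, mul_comm]
      rw [Finset.sum_congr rfl key, ← Finset.mul_sum, ← map_sum, hc, map_zero, mul_zero]
    · push Not at h
      exact Finset.sum_eq_zero fun t ht => by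
        rw [complProd_of_dep (h t ht), smul_zero]

variable {M : Type*} [AddCommGroup M] [Module K M]

theorem IsOrlikTerao.mono {v : ι → V} {A B : Finset ι} {F : Finset ι → M}
    (h : IsOrlikTerao K v B F) (hAB : A ⊆ B) : IsOrlikTerao K v A F where
  dep S hS := h.dep S (hS.trans hAB)
  rel T hT := h.rel T (hT.trans hAB)

/-- Pairing two functions makes the deletion–contraction step produce one family of coefficients
valid for both. -/
theorem IsOrlikTerao.prodMk {M' : Type*} [AddCommGroup M'] [Module K M'] {v : ι → V}
    {A : Finset ι} {F : Finset ι → M} {F' : Finset ι → M'} (h : IsOrlikTerao K v A F)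
    (h' : IsOrlikTerao K v A F') : IsOrlikTerao K v A fun S => (F S, F' S) where
  dep S hS hd := by rw [h.dep S hS hd, h'.dep S hS hd]; rfl
  rel T hT c hc := Prod.ext
    (by simpa [Prod.fst_sum] using h.rel T hT c hc) (by simpa [Prod.snd_sum] using h'.rel T hT c hc)

theorem IsOrlikTerao.eq_zero_of_loop {v : ι → V} {A : Finset ι} {F : Finset ι → M}
    (h : IsOrlikTerao K v A F) {e : ι} (he : e ∈ A) (hv : v e = 0) {S : Finset ι} (hS : S ⊆ A) :
    F S = 0 := by
  by_cases heS : e ∈ S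
  · refine h.dep S hS fun hi => ?_
    exact hi.ne_zero (i := e) heS hv
  · have := h.rel (insert e S) (Finset.insert_subset he hS) (Pi.single e 1)
      (Finset.sum_eq_zero fun t _ => by
        by_cases ht : t = e
        · rw [ht, hv, smul_zero]
        · rw [Pi.single_eq_of_ne ht, zero_smul])
    rw [Finset.sum_insert heS, Finset.sum_eq_zero (s := S) fun t ht => by
      rw [Pi.single_eq_of_ne (by rintro rfl; exact heS ht), zero_smul]] at this
    simpa [Finset.erase_insert heS] using this

/-- Independence in the contraction `V / ⟨v e⟩`. -/
theorem linearIndepOn_mkQ_iff {v : ι → V} {e : ι} (he : v e ≠ 0) {S : Finset ι} (heS : e ∉ S) :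
    LinearIndepOn K (fun t => (Submodule.span K {v e}).mkQ (v t)) (S : Set ι) ↔
      LinearIndepOn K v ((insert e S : Finset ι) : Set ι) := by
  rw [linearIndepOn_finset_iff, linearIndepOn_finset_iff]
  constructor
  · intro h f hf
    rw [Finset.sum_insert heS] at hf
    have hS : ∀ i ∈ S, f i = 0 := by
      refine h f ?_
      have := congrArg (Submodule.span K {v e}).mkQ hf
      have h0 : (Submodule.span K {v e}).mkQ (v e) = 0 :=
        (Submodule.Quotient.mk_eq_zero _).2 (Submodule.mem_span_singleton_self _)
      rw [map_add, map_smul, h0, smul_zero, zero_add, map_sum, map_zero] at this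
      simpa only [map_smul] using this
    rw [Finset.sum_eq_zero (s := S) fun i hi => by rw [hS i hi, zero_smul], add_zero] at hf
    intro i hi
    rcases Finset.mem_insert.1 hi with rfl | hi
    · exact (smul_eq_zero.1 hf).resolve_right he
    · exact hS i hi
  · intro h f hf i hi
    simp only [← map_smul] at hf
    rw [← map_sum] at hf
    obtain ⟨a, ha⟩ := Submodule.mem_span_singleton.1 ((Submodule.Quotient.mk_eq_zero _).1 hf)
    have hne : ∀ t ∈ S, t ≠ e := by rintro t ht rfl; exact heS ht
    have := h (fun t => if t = e then -a else f t) (by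
      rw [Finset.sum_insert heS, if_pos rfl, neg_smul, ha, neg_add_eq_zero]
      exact Finset.sum_congr rfl fun t ht => by simp only [if_neg (hne t ht)]) i (Finset.mem_insert_of_mem hi)
    rwa [if_neg (hne i hi)] at this

/-- The functions on the contraction coming from functions on the configuration, modulo the
functions on the deletion. -/
theorem IsOrlikTerao.contract {v : ι → V} {A : Finset ι} {e : ι} (heA : e ∉ A) (he : v e ≠ 0)
    {F : Finset ι → M} (h : IsOrlikTerao K v (insert e A) F) :
    IsOrlikTerao K (fun t => (Submodule.span K {v e}).mkQ (v t)) A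
      fun S => (Submodule.span K (F '' (A.powerset : Set (Finset ι)))).mkQ (F (insert e S)) where
  dep S hS hd := by
    rw [linearIndepOn_mkQ_iff he fun hm => heA (hS hm)] at hd
    rw [h.dep _ (Finset.insert_subset_insert e hS) hd, map_zero]
  rel T hT c hc := by
    have heT : e ∉ T := fun hm => heA (hT hm)
    have hne : ∀ t ∈ T, t ≠ e := by rintro t ht rfl; exact heT ht
    simp only [← map_smul] at hc ⊢
    rw [← map_sum] at hc
    refine (map_sum _ _ _).symm.trans ?_
    -- A dependence in the quotient lifts to one on `insert e T` with coefficient `-a` at `e`; its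
    -- extra term is a multiple of `F T`, which lies in the span of the deletion.
    obtain ⟨a, ha⟩ := Submodule.mem_span_singleton.1 ((Submodule.Quotient.mk_eq_zero _).1 hc)
    have := h.rel (insert e T) (Finset.insert_subset_insert e hT)
      (fun t => if t = e then -a else c t) (by
        rw [Finset.sum_insert heT, if_pos rfl, neg_smul, ha, neg_add_eq_zero]
        exact Finset.sum_congr rfl fun t ht => by simp only [if_neg (hne t ht)])
    rw [Finset.sum_insert heT, if_pos rfl, Finset.erase_insert heT, neg_smul,
      Finset.sum_congr rfl fun t ht => by
        rw [if_neg (hne t ht), Finset.erase_insert_of_ne (hne t ht).symm],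
      neg_add_eq_zero] at this
    refine (Submodule.Quotient.mk_eq_zero _).2 ?_
    rw [← this]
    exact Submodule.smul_mem _ _ (Submodule.subset_span ⟨T, by simpa using hT, rfl⟩)

/-- Restriction of complementary products to the contraction. -/
theorem lift_mkQ_complProd_insert {v : ι → V} {A : Finset ι} {e : ι} (heA : e ∉ A) (he : v e ≠ 0)
    {S : Finset ι} (hS : S ⊆ A) :
    SymmetricAlgebra.lift (SymmetricAlgebra.ι K _ ∘ₗ (Submodule.span K {v e}).mkQ)
        (complProd K v (insert e A) (insert e S)) =
      complProd K (fun t => (Submodule.span K {v e}).mkQ (v t)) A S := by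
  have heS : e ∉ S := fun hm => heA (hS hm)
  by_cases hi : LinearIndepOn K v ((insert e S : Finset ι) : Set ι)
  · rw [complProd_of_indep hi, complProd_of_indep ((linearIndepOn_mkQ_iff he heS).2 hi), map_prod]
    have hsd : insert e A \ insert e S = A \ S := by
      rw [Finset.insert_sdiff_insert, Finset.sdiff_insert, Finset.erase_eq_of_notMem]
      exact fun hm => heA (Finset.mem_sdiff.1 hm).1
    rw [hsd]
    exact Finset.prod_congr rfl fun t _ => SymmetricAlgebra.lift_ι_apply _ _
  · rw [complProd_of_dep hi, complProd_of_dep (mt (linearIndepOn_mkQ_iff he heS).1 hi), map_zero]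

theorem complProd_insert {v : ι → V} {A : Finset ι} {e : ι} (heA : e ∉ A) {S : Finset ι}
    (hS : S ⊆ A) :
    complProd K v (insert e A) S = SymmetricAlgebra.ι K V (v e) * complProd K v A S := by
  by_cases hi : LinearIndepOn K v (S : Set ι)
  · rw [complProd_of_indep hi, complProd_of_indep hi,
      Finset.insert_sdiff_of_notMem _ fun hm => heA (hS hm), Finset.prod_insert]
    exact fun hm => heA (Finset.mem_sdiff.1 hm).1
  · rw [complProd_of_dep hi, complProd_of_dep hi, mul_zero]

theorem lift_mkQ_complProd {v : ι → V} {A : Finset ι} {e : ι} (heA : e ∉ A) {S : Finset ι}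
    (hS : S ⊆ A) :
    SymmetricAlgebra.lift (SymmetricAlgebra.ι K _ ∘ₗ (Submodule.span K {v e}).mkQ)
        (complProd K v (insert e A) S) = 0 := by
  have h0 : (Submodule.span K {v e}).mkQ (v e) = 0 :=
    (Submodule.Quotient.mk_eq_zero _).2 (Submodule.mem_span_singleton_self _)
  rw [complProd_insert heA hS, map_mul, SymmetricAlgebra.lift_ι_apply, LinearMap.comp_apply, h0,
    map_zero, zero_mul]

theorem symmetricAlgebra_ι_ne_zero {x : V} (hx : x ≠ 0) : SymmetricAlgebra.ι K V x ≠ 0 := by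
  obtain ⟨f, hf⟩ := Module.Projective.exists_dual_ne_zero K hx
  intro h
  apply hf
  rw [← SymmetricAlgebra.lift_ι_apply f x, h, map_zero]

/-- The linear relations between the complementary products hold for every function satisfying the
Orlik-Terao relations. -/
theorem IsOrlikTerao.sum_eq_zero {K : Type u} [Field K] {V : Type u} [AddCommGroup V]
    [Module K V] {v : ι → V} {A : Finset ι} {M : Type u} [AddCommGroup M] [Module K M] {F : Finset ι → M}
    (hF : IsOrlikTerao K v A F) {a : Finset ι → K}
    (ha : ∑ S ∈ A.powerset, a S • complProd K v A S = 0) :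
    ∑ S ∈ A.powerset, a S • F S = 0 := by
  induction A using Finset.induction generalizing V M a with
  | empty =>
    have h1 : complProd K v ∅ ∅ = 1 := by
      rw [complProd_of_indep (by simp)]; simp
    rw [Finset.powerset_empty, Finset.sum_singleton, h1, smul_eq_zero] at ha
    rw [Finset.powerset_empty, Finset.sum_singleton, ha.resolve_right one_ne_zero, zero_smul]
  | insert e A heA ih =>
    by_cases he : v e = 0
    · exact Finset.sum_eq_zero fun S hS => by
        rw [hF.eq_zero_of_loop (Finset.mem_insert_self e A) he (Finset.mem_powerset.1 hS),
          smul_zero]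
    -- The target module becomes `M × SymmetricAlgebra K V` modulo the values on the deletion, so
    -- the induction must allow `M` to vary.
    have hFP := hF.prodMk (isOrlikTerao_complProd (K := K) v (insert e A))
    -- Modulo `v e` the terms of `ha` with `e ∉ S` vanish, which leaves a relation for the
    -- contraction.
    have hc := ih (hFP.contract heA he) (a := fun S => a (insert e S)) (by
      have := congrArg (SymmetricAlgebra.lift
        (SymmetricAlgebra.ι K _ ∘ₗ (Submodule.span K {v e}).mkQ)) ha
      rw [Finset.sum_powerset_insert heA, map_add, map_sum, map_sum, map_zero,
        Finset.sum_eq_zero, zero_add] at this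
      · rw [← this]
        refine Finset.sum_congr rfl fun S hS => ?_
        rw [map_smul, lift_mkQ_complProd_insert heA he (Finset.mem_powerset.1 hS)]
      · intro S hS
        rw [map_smul, lift_mkQ_complProd heA (Finset.mem_powerset.1 hS), smul_zero])
    simp only [← map_smul] at hc
    replace hc := (map_sum _ _ _).trans hc
    -- The same `b` rewrites the terms containing `e` through subsets of `A`, both for `F` and for
    -- the complementary products.
    obtain ⟨b, hb⟩ := (Submodule.mem_span_image_finset_iff_exists_fun K).1
      ((Submodule.Quotient.mk_eq_zero _).1 hc)
    obtain ⟨b, rfl⟩ : ∃ b' : Finset ι → K, b = fun i => b' i.1 :=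
      ⟨fun S => if h : S ∈ A.powerset then b ⟨S, h⟩ else 0, by
        funext i; simp only [dif_pos i.2]⟩
    rw [Finset.sum_coe_sort A.powerset fun S => b S • (F S, complProd K v (insert e A) S)] at hb
    have hb1 := congrArg Prod.fst hb
    have hb2 := congrArg Prod.snd hb
    simp only [Prod.fst_sum, Prod.snd_sum, Prod.smul_fst, Prod.smul_snd] at hb1 hb2
    rw [Finset.sum_powerset_insert heA] at ha ⊢
    rw [← hb2, ← Finset.sum_add_distrib] at ha
    rw [← hb1, ← Finset.sum_add_distrib]
    simp only [← add_smul] at ha ⊢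
    -- Only subsets of `A` remain, and all their complementary products share the factor `v e`,
    -- which can be cancelled in the domain `SymmetricAlgebra K V`.
    refine ih (hF.mono (Finset.subset_insert e A)) (a := fun S => a S + b S) ?_
    refine (mul_eq_zero.1 (Eq.trans ?_ ha)).resolve_left (symmetricAlgebra_ι_ne_zero (K := K) he)
    rw [Finset.mul_sum]
    refine Finset.sum_congr rfl fun S hS => ?_
    rw [complProd_insert heA (Finset.mem_powerset.1 hS), mul_smul_comm]

end VectorConfigurations

/-! ### Commuting operators on the Orlik–Terao functions. -/

section Action

variable {K : Type*} [Field K] {ι : Type*} [DecidableEq ι]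

/-- Adding an element to the argument of a function of finite sets, and killing the value if the
element is there already. -/
def insertOp (K : Type*) [Field K] {ι : Type*} [DecidableEq ι] (M : Type*) [AddCommGroup M]
    [Module K M] (d : ι) : (Finset ι → M) →ₗ[K] (Finset ι → M) where
  toFun F S := if d ∈ S then 0 else F (insert d S)
  map_add' F F' := by ext S; by_cases h : d ∈ S <;> simp [h]
  map_smul' c F := by ext S; by_cases h : d ∈ S <;> simp [h]

variable {V : Type*} [AddCommGroup V] [Module K V] {M : Type*} [AddCommGroup M] [Module K M]

theorem insertOp_apply (d : ι) (F : Finset ι → M) (S : Finset ι) :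
    insertOp K M d F S = if d ∈ S then 0 else F (insert d S) := rfl

theorem IsOrlikTerao.insertOp [Fintype ι] {v : ι → V} {F : Finset ι → M}
    (h : IsOrlikTerao K v Finset.univ F) (d : ι) :
    IsOrlikTerao K v Finset.univ (insertOp K M d F) where
  dep S _ hS := by
    rw [insertOp_apply]
    split_ifs
    · rfl
    · exact h.dep _ (Finset.subset_univ _) fun hi => hS (hi.mono (by simp))
  rel T _ c hc := by
    simp only [insertOp_apply]
    -- If `d ∈ T`, only the term `c d • F T` survives, and `c d ≠ 0` makes `T` dependent. Otherwise
    -- `c` is extended by zero to `insert d T`.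
    by_cases hd : d ∈ T
    · rw [← Finset.add_sum_erase _ _ hd, if_neg (Finset.notMem_erase d T), Finset.insert_erase hd,
        Finset.sum_eq_zero fun t ht => by
          rw [if_pos (Finset.mem_erase.2 ⟨(Finset.ne_of_mem_erase ht).symm, hd⟩), smul_zero],
        add_zero]
      by_cases h0 : c d = 0
      · rw [h0, zero_smul]
      · rw [h.dep T (Finset.subset_univ _) fun hi => h0 (linearIndepOn_finset_iff.1 hi c hc d hd),
          smul_zero]
    · have hne : ∀ t ∈ T, t ≠ d := by rintro t ht rfl; exact hd ht
      have := h.rel (insert d T) (Finset.subset_univ _) (fun t => if t = d then 0 else c t) (by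
        rw [Finset.sum_insert hd, if_pos rfl, zero_smul, zero_add, ← hc]
        exact Finset.sum_congr rfl fun t ht => by rw [if_neg (hne t ht)])
      rw [Finset.sum_insert hd, if_pos rfl, zero_smul, zero_add] at this
      rw [← this]
      refine Finset.sum_congr rfl fun t ht => ?_
      rw [if_neg fun hm => hd (Finset.mem_of_mem_erase hm), if_neg (hne t ht),
        Finset.erase_insert_of_ne (hne t ht).symm]

/-- The space of the functions satisfying the Orlik-Terao relations. -/
def orlikTeraoFun (K : Type*) [Field K] {ι : Type*} [DecidableEq ι] [Fintype ι] {V : Type*}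
    [AddCommGroup V] [Module K V] (v : ι → V) (M : Type*) [AddCommGroup M] [Module K M] :
    Submodule K (Finset ι → M) where
  carrier := {F | IsOrlikTerao K v Finset.univ F}
  zero_mem' := ⟨fun _ _ _ => rfl, fun _ _ _ _ => by simp⟩
  add_mem' h h' := ⟨fun S hS hd => by rw [Pi.add_apply, h.dep S hS hd, h'.dep S hS hd, add_zero],
    fun T hT c hc => by
      simp only [Pi.add_apply, smul_add, Finset.sum_add_distrib, h.rel T hT c hc,
        h'.rel T hT c hc, add_zero]⟩
  smul_mem' a _ h := ⟨fun S hS hd => by rw [Pi.smul_apply, h.dep S hS hd, smul_zero],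
    fun T hT c hc => by
      simp only [Pi.smul_apply, smul_comm _ a, ← Finset.smul_sum, h.rel T hT c hc, smul_zero]⟩

variable [Fintype ι]

/-- The action of an element of the configuration on the functions satisfying the Orlik-Terao
relations. -/
def otAct (K : Type*) [Field K] {ι : Type*} [DecidableEq ι] [Fintype ι] {V : Type*}
    [AddCommGroup V] [Module K V] (v : ι → V) (M : Type*) [AddCommGroup M] [Module K M] (d : ι) :
    Module.End K (orlikTeraoFun K v M) :=
  (insertOp K M d).restrict fun _ hF => IsOrlikTerao.insertOp hF d

theorem otAct_apply {v : ι → V} (d : ι) (F : orlikTeraoFun K v M) (S : Finset ι) :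
    (otAct K v M d F : Finset ι → M) S =
      if d ∈ S then 0 else (F : Finset ι → M) (insert d S) := rfl

theorem otAct_mul_self (v : ι → V) (d : ι) : otAct K v M d * otAct K v M d = 0 := by
  ext F S
  simp [otAct_apply]

theorem otAct_commute (v : ι → V) (d e : ι) : Commute (otAct K v M d) (otAct K v M e) := by
  ext F S
  simp only [Module.End.mul_apply, otAct_apply, Finset.mem_insert, Finset.insert_comm d e S,
    eq_comm (a := d) (b := e)]
  by_cases h1 : d ∈ S <;> by_cases h2 : e ∈ S <;> by_cases h3 : e = d <;> simp [h1, h2, h3]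

/-- The value of `R F` at `insert d S` is that of `R (otAct d F)` at `S`, so relations between the
operators need checking only at `∅`. There they become Orlik–Terao relations with all coefficients
1. -/
theorem end_eq_zero_of_commute {v : ι → V} {R : Module.End K (orlikTeraoFun K v M)}
    (hc : ∀ d, Commute R (otAct K v M d))
    (h : ∀ F : orlikTeraoFun K v M, (R F : Finset ι → M) ∅ = 0) : R = 0 := by
  ext F S
  induction S using Finset.induction generalizing F with
  | empty => exact h F
  | insert d S hd ih =>
    have h1 := otAct_apply d (R F) S
    rw [if_neg hd] at h1
    rw [← h1, ← Module.End.mul_apply, ← (hc d).eq, Module.End.mul_apply, ih]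
    rfl

theorem otAct_add_eq_zero {v : ι → V} {d e : ι} (hde : d ≠ e) (h : v e = -v d) :
    otAct K v M d + otAct K v M e = 0 := by
  refine end_eq_zero_of_commute (fun a => (otAct_commute v d a).add_left (otAct_commute v e a)) ?_
  rintro ⟨F, hF⟩
  change F {d} + F {e} = 0
  have := hF.rel {d, e} (Finset.subset_univ _) 1 (by simp [Finset.sum_pair hde, h])
  rw [Finset.sum_pair hde] at this
  simpa [Finset.erase_insert_of_ne hde, Finset.erase_insert, hde, add_comm] using this

theorem otAct_triangle {v : ι → V} {a b c : ι} (hab : a ≠ b) (hbc : b ≠ c) (hca : c ≠ a)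
    (h : v a + v b + v c = 0) :
    otAct K v M a * otAct K v M b + otAct K v M b * otAct K v M c +
      otAct K v M c * otAct K v M a = 0 := by
  refine end_eq_zero_of_commute (fun d => ?_) ?_
  · have := fun e => otAct_commute (K := K) (M := M) v e d
    exact (((this a).mul_left (this b)).add_left ((this b).mul_left (this c))).add_left
      ((this c).mul_left (this a))
  rintro ⟨F, hF⟩
  have h1 : ∀ d e : ι, e ≠ d → ((otAct K v M e * otAct K v M d) ⟨F, hF⟩ : Finset ι → M) ∅ =
      F {d, e} := by
    intro d e hed
    simp [Module.End.mul_apply, otAct_apply, hed.symm]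
  change ((otAct K v M a * otAct K v M b) ⟨F, hF⟩ : Finset ι → M) ∅ +
    ((otAct K v M b * otAct K v M c) ⟨F, hF⟩ : Finset ι → M) ∅ +
    ((otAct K v M c * otAct K v M a) ⟨F, hF⟩ : Finset ι → M) ∅ = 0
  rw [h1 _ _ hab, h1 _ _ hbc, h1 _ _ hca]
  have ha : a ∉ ({b, c} : Finset ι) := by simp [hab, hca.symm]
  have hb : b ∉ ({c} : Finset ι) := by simp [hbc]
  have := hF.rel {a, b, c} (Finset.subset_univ _) 1 (by
    rw [Finset.sum_insert ha, Finset.sum_pair hbc]; simp [← h, add_assoc])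
  rw [Finset.sum_insert ha, Finset.sum_pair hbc, Finset.erase_insert ha] at this
  have e1 : ({a, b, c} : Finset ι).erase b = {a, c} := by
    rw [Finset.erase_insert_of_ne hab, Finset.erase_insert hb]
  have e2 : ({a, b, c} : Finset ι).erase c = {a, b} := by
    rw [Finset.erase_insert_of_ne hca.symm, Finset.erase_insert_of_ne hbc, Finset.erase_singleton,
      insert_empty_eq]
  rw [e1, e2, Finset.pair_comm b c] at this
  rw [← this, Finset.pair_comm b a]
  simp only [Pi.one_apply, one_smul]
  abel

end Action

/-! ### The relation of a cycle in the Fomin–Kirillov algebra. -/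

section Walks

variable {V : Type*} {H : SimpleGraph V}

/-- The product of the values of `x` along the edges of a walk. -/
def walkProd {R : Type*} [Monoid R] (x : V → V → R) : ∀ {a b : V}, H.Walk a b → R
  | _, _, .nil => 1
  | _, _, .cons (u := a) (v := b) _ w => x a b * walkProd x w

/-- The sum over the edges of a walk of the products in which this edge is left out, where the
edges behind it come first, then `z`, and then the edges before it. -/
def walkRot {R : Type*} [Semiring R] (x : V → V → R) : ∀ {a b : V}, H.Walk a b → R → R
  | _, _, .nil, _ => 0
  | _, _, .cons (u := a) (v := b) _ w, z => walkProd x w * z + walkRot x w (z * x a b)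

theorem walkRot_cons {R : Type*} [Semiring R] (x : V → V → R) {a b c : V} (e : H.Adj a b)
    (w : H.Walk b c) (z : R) :
    walkRot x (.cons e w) z = walkProd x w * z + walkRot x w (z * x a b) := by
  rw [walkRot]

section Noncommutative

variable {R : Type*} [Ring R] (x : V → V → R)

theorem map_walkProd {S : Type*} [Semiring S] {R : Type*} [Semiring R] (f : R →+* S)
    {x : V → V → R} {y : V → V → S} (h : ∀ a b, H.Adj a b → f (x a b) = y a b) {a b : V}
    (w : H.Walk a b) : f (walkProd x w) = walkProd y w := by
  induction w with
  | nil => exact map_one f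
  | cons e w ih => rw [walkProd, walkProd, map_mul, ih, h _ _ e]

theorem map_walkRot {S : Type*} [Semiring S] {R : Type*} [Semiring R] (f : R →+* S)
    {x : V → V → R} {y : V → V → S} (h : ∀ a b, H.Adj a b → f (x a b) = y a b) {a b : V}
    (w : H.Walk a b) (z : R) : f (walkRot x w z) = walkRot y w (f z) := by
  induction w generalizing z with
  | nil => exact map_zero f
  | cons e w ih =>
    rw [walkRot, walkRot, map_add, map_mul, ih, map_walkProd f h, map_mul, h _ _ e]

theorem walkRot_add {a b : V} (w : H.Walk a b) (z z' : R) :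
    walkRot x w (z + z') = walkRot x w z + walkRot x w z' := by
  induction w generalizing z z' with
  | nil => simp [walkRot]
  | cons e w ih => simp only [walkRot, add_mul, mul_add, ih]; abel

theorem commute_walkProd {a b : V} (w : H.Walk a b) {r : R}
    (h : ∀ c ∈ w.support, ∀ d ∈ w.support, Commute r (x c d)) : Commute r (walkProd x w) := by
  induction w with
  | nil => exact Commute.one_right r
  | cons e w ih =>
    refine (h _ (by simp) _ (by simp)).mul_right (ih fun c hc d hd => h c ?_ d ?_) <;> simp [*]

/-- A factor commuting with all edges behind the first one can be taken out on the left. -/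
theorem walkRot_mul_left {a b c : V} (e : H.Adj a b) (w : H.Walk b c) {r : R}
    (h : ∀ c ∈ w.support, ∀ d ∈ w.support, Commute r (x c d)) (z : R) :
    walkRot x (.cons e w) (r * z) = r * walkRot x (.cons e w) z := by
  induction w generalizing a z with
  | nil => simp [walkRot, walkProd]
  | cons e' w ih =>
    have hw := commute_walkProd x (.cons e' w) h
    rw [walkRot, mul_assoc, ih e' (fun c hc d hd => h c (by simp [hc]) d (by simp [hd])),
      walkRot_cons x e, mul_add, ← mul_assoc, ← mul_assoc, hw.eq]

/-- A factor commuting with all edges that do not meet the end of a path can be taken out on the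
right. -/
theorem walkRot_mul_right {a b : V} (w : H.Walk a b) (hp : w.IsPath) {r : R}
    (h : ∀ c ∈ w.support, ∀ d ∈ w.support, c ≠ b → d ≠ b → Commute r (x c d)) (z : R) :
    walkRot x w (z * r) = walkRot x w z * r := by
  induction w generalizing z with
  | nil => simp [walkRot]
  | @cons a b m e w ih =>
    rw [SimpleGraph.Walk.cons_isPath_iff] at hp
    rw [walkRot_cons, walkRot_cons, add_mul, mul_assoc (walkProd x w)]
    suffices hs : walkRot x w (z * r * x a b) = walkRot x w (z * x a b) * r by rw [hs]
    -- The last edge never occurs to the right of `z`, so `r` need not commute with it.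
    cases w with
    | nil => simp [walkRot]
    | cons e' w =>
      have hbm : b ≠ m := by
        rintro rfl
        exact (SimpleGraph.Walk.cons_isPath_iff _ _).1 hp.1 |>.2 w.end_mem_support
      have ham : a ≠ m := by
        rintro rfl
        exact hp.2 (SimpleGraph.Walk.end_mem_support _)
      have hc : Commute r (x a b) := h a (by simp) b (by simp) ham hbm
      rw [mul_assoc, hc.eq, ← mul_assoc, ih hp.1 fun c hc d hd => h c ?_ d ?_]
      · exact List.mem_cons_of_mem _ hc
      · exact List.mem_cons_of_mem _ hd

/-- The cyclic relation of the Fomin-Kirillov algebra. -/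
theorem walkProd_eq_walkRot (hneg : ∀ a b, x a b = -x b a)
    (hcomm : ∀ a b c d, a ≠ b → c ≠ d → a ≠ c → a ≠ d → b ≠ c → b ≠ d → Commute (x a b) (x c d))
    (hself : ∀ a, x a a = 0)
    (htri : ∀ a b c, a ≠ b → b ≠ c → c ≠ a → x a b * x b c + x b c * x c a + x c a * x a b = 0)
    {a b : V} (w : H.Walk a b) (hp : w.IsPath) (hab : a ≠ b) :
    walkProd x w = walkRot x w (x a b) := by
  -- The value zero on the diagonal allows commutation with `x c d` for all pairs of vertices of a
  -- walk, equal ones included.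
  have hcomm' : ∀ a b c d, a ≠ b → a ≠ c → a ≠ d → b ≠ c → b ≠ d → Commute (x a b) (x c d) := by
    intro a b c d h1 h2 h3 h4 h5
    by_cases hcd : c = d
    · subst hcd; rw [hself]; exact Commute.zero_right _
    · exact hcomm _ _ _ _ h1 hcd h2 h3 h4 h5
  induction w with
  | nil => exact absurd rfl hab
  | @cons a b m e w ih =>
    rw [SimpleGraph.Walk.cons_isPath_iff] at hp
    cases w with
    | nil => simp [walkProd, walkRot]
    | @cons _ c _ e' w =>
      have hp' := (SimpleGraph.Walk.cons_isPath_iff _ _).1 hp.1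
      have hbm : b ≠ m := by rintro rfl; exact hp'.2 w.end_mem_support
      have hne : ∀ d ∈ (SimpleGraph.Walk.cons e' w).support, a ≠ d := by
        rintro d hd rfl; exact hp.2 hd
      have hne' : ∀ d ∈ w.support, b ≠ d := by
        rintro d hd rfl; exact hp'.2 hd
      -- The factor `x a b` commutes with all edges of the tail that avoid `b`, so it moves inside
      -- the rotation next to `x b m`, where the triangle a, b, m applies.
      rw [walkProd, walkRot, ih hp.1 hbm, ← walkRot_mul_left x e' w fun d hd d' hd' =>
        hcomm' _ _ _ _ e.ne (hne d (List.mem_cons_of_mem _ hd)) (hne d' (List.mem_cons_of_mem _ hd'))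
          (hne' d hd) (hne' d' hd')]
      have ht : x a b * x b m = x b m * x a m + x a m * x a b := by
        have := htri a b m e.ne hbm hab.symm
        rw [hneg m a] at this
        rw [mul_neg, neg_mul] at this
        rw [← sub_eq_zero, ← this]
        abel
      -- In the first summand `x a m` moves out to the right, as it commutes with the edges that
      -- avoid `m`.
      rw [ht, walkRot_add, walkRot_mul_right x _ hp.1 fun d hd d' hd' h h' =>
        hcomm' _ _ _ _ hab (hne d hd) (hne d' hd') h.symm h'.symm]

end Noncommutative

end Walks

/-! ### From cycle relations to all Orlik–Terao relations. -/

section CircuitRelations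

/-- Elements of a commutative algebra attached to the ordered pairs of vertices that satisfy the
cyclic relations of the Fomin-Kirillov algebra along the cycles of `G`. -/
structure IsCyclicSystem {n : ℕ} (G : SimpleGraph (Fin n)) {C : Type*} [CommRing C]
    (y : Fin n → Fin n → C) : Prop where
  neg : ∀ a b, y a b = -y b a
  mul_self : ∀ a b, y a b * y a b = 0
  cyclic : ∀ H : SimpleGraph (Fin n), H ≤ G → ∀ {a b : Fin n} (w : H.Walk a b), w.IsPath →
    G.Adj a b → walkProd y w = walkRot y w (y a b)

variable {n : ℕ} {G : SimpleGraph (Fin n)} {C : Type*} [CommRing C] [Algebra ℚ C]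
  {y : Fin n → Fin n → C} {κ : Type*}

/-- The graph formed by the edges with index in `Q`. -/
def indexedGraph (d : κ → G.Dart) (Q : Finset κ) : SimpleGraph (Fin n) :=
  SimpleGraph.fromEdgeSet ((fun q => (d q).edge) '' (Q : Set κ))

theorem indexedGraph_adj_iff (d : κ → G.Dart) (Q : Finset κ) (a b : Fin n) :
    (indexedGraph d Q).Adj a b ↔ ∃ q ∈ Q, (d q).edge = s(a, b) := by
  simp only [indexedGraph, SimpleGraph.fromEdgeSet_adj, Set.mem_image, Finset.mem_coe]
  refine ⟨fun h => h.1, fun h => ⟨h, ?_⟩⟩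
  obtain ⟨q, -, hq⟩ := h
  have := (d q).edge_mem
  rw [hq, SimpleGraph.mem_edgeSet] at this
  exact this.ne

theorem indexedGraph_le (d : κ → G.Dart) (Q : Finset κ) : indexedGraph d Q ≤ G := by
  intro a b h
  obtain ⟨q, -, hq⟩ := (indexedGraph_adj_iff d Q a b).1 h
  have := (d q).edge_mem
  rwa [hq, SimpleGraph.mem_edgeSet] at this

theorem exists_sign_of_edge_eq (hy : ∀ a b, y a b = -y b a) (d : G.Dart) {a b : Fin n}
    (h : d.edge = s(a, b)) : ∃ σ : ℚ, σ * σ = 1 ∧ y a b = σ • y d.fst d.snd ∧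
      σ • edgeVec d = Pi.single a 1 - Pi.single b 1 ∧
      (d.fst = a ∧ d.snd = b ∨ d.fst = b ∧ d.snd = a) := by
  have h' : s(d.fst, d.snd) = s(a, b) := h
  rw [Sym2.eq_iff] at h'
  rcases h' with ⟨h1, h2⟩ | ⟨h1, h2⟩
  · exact ⟨1, by norm_num, by rw [h1, h2, one_smul], by rw [edgeVec, h1, h2, one_smul],
      Or.inl ⟨h1, h2⟩⟩
  · exact ⟨-1, by norm_num, by rw [h1, h2, neg_one_smul, hy],
      by rw [edgeVec, h1, h2, neg_one_smul, neg_sub], Or.inr ⟨h1, h2⟩⟩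

variable [DecidableEq κ]

/-- Translates a path into the set `R` of indices it uses: `s` records the orientations and `ε` is
their product. Leaving out the edge of `r` changes the sign by `s r`, since signs are their own
inverses. -/
theorem exists_walkProd_eq (hy : ∀ a b, y a b = -y b a) (d : κ → G.Dart) (Q : Finset κ)
    {a b : Fin n} (w : (indexedGraph d Q).Walk a b) (hw : w.IsPath) :
    ∃ (R : Finset κ) (s : κ → ℚ) (ε : ℚ), R ⊆ Q ∧ ε ≠ 0 ∧
      (∀ r ∈ R, (d r).fst ∈ w.support ∧ (d r).snd ∈ w.support) ∧
      ∑ r ∈ R, s r • edgeVec (d r) = Pi.single a 1 - Pi.single b 1 ∧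
      walkProd y w = ε • ∏ r ∈ R, y (d r).fst (d r).snd ∧
      ∀ z, walkRot y w z = ε • (z * ∑ r ∈ R, s r • ∏ q ∈ R.erase r, y (d q).fst (d q).snd) := by
  induction w with
  | nil => exact ⟨∅, 0, 1, by simp, one_ne_zero, by simp, by simp, by simp [walkProd],
      by simp [walkRot]⟩
  | @cons a b c e w ih =>
    rw [SimpleGraph.Walk.cons_isPath_iff] at hw
    obtain ⟨R, s, ε, hRQ, hε, hsupp, hvec, hprod, hrot⟩ := ih hw.1
    obtain ⟨q, hqQ, hq⟩ := (indexedGraph_adj_iff d Q _ _).1 e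
    obtain ⟨σ, hσ, hyσ, hvσ, hends⟩ := exists_sign_of_edge_eq hy (d q) hq
    -- The start `a` of the new edge is not on the rest of the path, which contains both ends of
    -- every dart of `R`.
    have hqR : q ∉ R := by
      intro hm
      rcases hends with h | h
      · exact hw.2 (h.1 ▸ (hsupp q hm).1)
      · exact hw.2 (h.2 ▸ (hsupp q hm).2)
    have hne : ∀ r ∈ R, r ≠ q := by rintro r hr rfl; exact hqR hr
    refine ⟨insert q R, Function.update s q σ, σ * ε, Finset.insert_subset hqQ hRQ,
      mul_ne_zero (by rintro rfl; norm_num at hσ) hε, ?_, ?_, ?_, ?_⟩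
    · intro r hr
      rw [SimpleGraph.Walk.support_cons]
      rcases Finset.mem_insert.1 hr with rfl | hr
      · rcases hends with h | h <;> rw [h.1, h.2] <;> simp
      · exact ⟨List.mem_cons_of_mem _ (hsupp r hr).1, List.mem_cons_of_mem _ (hsupp r hr).2⟩
    · rw [Finset.sum_insert hqR, Function.update_self, hvσ, Finset.sum_congr rfl fun r hr => by
        rw [Function.update_of_ne (hne r hr)], hvec]
      abel
    · rw [walkProd, hprod, hyσ, Finset.prod_insert hqR, smul_mul_smul_comm]
    · intro z
      rw [walkRot, hprod, hrot, hyσ, Finset.sum_insert hqR, Function.update_self,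
        Finset.erase_insert hqR, mul_add, smul_add]
      congr 1
      · rw [mul_smul_comm, smul_smul, smul_mul_assoc, mul_comm z, mul_right_comm, hσ, one_mul]
      · have : ∀ r ∈ R, Function.update s q σ r • ∏ t ∈ (insert q R).erase r,
            y (d t).fst (d t).snd = y (d q).fst (d q).snd *
              s r • ∏ t ∈ R.erase r, y (d t).fst (d t).snd := by
          intro r hr
          rw [Function.update_of_ne (hne r hr), Finset.erase_insert_of_ne (hne r hr).symm,
            Finset.prod_insert fun hm => hqR (Finset.mem_of_mem_erase hm), mul_smul_comm]
        rw [Finset.sum_congr rfl this, ← Finset.mul_sum, ← mul_assoc, mul_smul_comm,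
          smul_mul_assoc, smul_smul, mul_comm ε σ]

variable [Fintype κ]

theorem sum_ite_smul {N : Type*} [AddCommGroup N] [Module ℚ N] {R : Finset κ} {p : κ}
    (hp : p ∉ R) (s : κ → ℚ) (f : κ → N) :
    ∑ r, (if r = p then 1 else if r ∈ R then s r else 0 : ℚ) • f r =
      f p + ∑ r ∈ R, s r • f r := by
  rw [← Finset.sum_subset (Finset.subset_univ (insert p R)), Finset.sum_insert hp, if_pos rfl,
    one_smul]
  · exact congrArg _ (Finset.sum_congr rfl fun r hr => by
      rw [if_neg (by rintro rfl; exact hp hr), if_pos hr])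
  · intro r _ hr
    rw [Finset.mem_insert, not_or] at hr
    rw [if_neg hr.1, if_neg hr.2, zero_smul]

/-- A path from the head of `d p` back to its tail closes up to a circuit. Its cyclic relation,
multiplied by the factors outside the circuit, is the one required. A path of length one covers a
repeated edge. -/
theorem IsCyclicSystem.exists_circuit (hy : IsCyclicSystem G y) (d : κ → G.Dart) {Q : Finset κ}
    {p : κ} (hp : p ∉ Q) (h : (indexedGraph d Q).Reachable (d p).fst (d p).snd) :
    ∃ s : κ → ℚ, s p ≠ 0 ∧ (∀ r, s r ≠ 0 → r ∈ insert p Q) ∧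
      ∑ r, s r • edgeVec (d r) = 0 ∧
      ∑ r, s r • ∏ q ∈ Finset.univ.erase r, y (d q).fst (d q).snd = 0 := by
  obtain ⟨w, hw⟩ := h.symm.exists_isPath
  obtain ⟨R, s, ε, hRQ, hε, -, hvec, hprod, hrot⟩ := exists_walkProd_eq hy.neg d Q w hw
  have hrel := hy.cyclic _ (indexedGraph_le d Q) w hw (d p).adj.symm
  rw [hprod, hrot, smul_right_inj hε, hy.neg, neg_mul] at hrel
  have hpR : p ∉ R := fun hm => hp (hRQ hm)
  have hne : ∀ r ∈ R, r ≠ p := by rintro r hr rfl; exact hpR hr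
  refine ⟨fun r => if r = p then 1 else if r ∈ R then s r else 0, by simp, ?_, ?_, ?_⟩
  · intro r hr
    by_cases hrp : r = p
    · exact hrp ▸ Finset.mem_insert_self _ _
    · by_cases hrR : r ∈ R
      · exact Finset.mem_insert_of_mem (hRQ hrR)
      · simp [hrp, hrR] at hr
  · rw [sum_ite_smul hpR, hvec, edgeVec]
    abel
  · rw [sum_ite_smul hpR]
    have hsplit : ∀ r ∈ insert p R, ∏ q ∈ Finset.univ.erase r, y (d q).fst (d q).snd =
        (∏ q ∈ Finset.univ \ insert p R, y (d q).fst (d q).snd) *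
          ∏ q ∈ (insert p R).erase r, y (d q).fst (d q).snd := by
      intro r hr
      rw [← Finset.prod_union]
      · congr 1
        ext q
        by_cases hq : q ∈ insert p R
        · simp [hq]
        · simp only [Finset.mem_erase, Finset.mem_univ, Finset.mem_union, Finset.mem_sdiff, hq]
          simp only [and_true, not_false_iff, true_or, iff_true]
          rintro rfl
          exact hq hr
      · exact Finset.sdiff_disjoint.mono_right (Finset.erase_subset _ _)
    have hrest : ∑ r ∈ R, s r • ∏ q ∈ Finset.univ.erase r, y (d q).fst (d q).snd =
        (∏ q ∈ Finset.univ \ insert p R, y (d q).fst (d q).snd) * (y (d p).fst (d p).snd *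
          ∑ r ∈ R, s r • ∏ q ∈ R.erase r, y (d q).fst (d q).snd) := by
      rw [Finset.mul_sum, Finset.mul_sum]
      refine Finset.sum_congr rfl fun r hr => ?_
      rw [hsplit r (Finset.mem_insert_of_mem hr), Finset.erase_insert_of_ne (hne r hr).symm,
        Finset.prod_insert fun hm => hpR (Finset.mem_of_mem_erase hm), mul_smul_comm,
        mul_smul_comm]
    rw [hsplit p (Finset.mem_insert_self _ _), Finset.erase_insert hpR, hrel, hrest, ← mul_add,
      neg_add_cancel, mul_zero]

/-- Pair the dependence with the indicator function `χ` of the component of `(d p).fst`: the other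
darts in the support contribute zero, so `d p` must not leave the component either. -/
theorem reachable_of_dependence (d : κ → G.Dart) {c : κ → ℚ}
    (hc : ∑ r, c r • edgeVec (d r) = 0) {p : κ} (hp : c p ≠ 0) :
    (indexedGraph d ((Finset.univ.filter fun r => c r ≠ 0).erase p)).Reachable
      (d p).fst (d p).snd := by
  classical
  by_contra hnr
  set H := indexedGraph d ((Finset.univ.filter fun r => c r ≠ 0).erase p) with hH
  let χ : Fin n → ℚ := fun x => if H.Reachable (d p).fst x then 1 else 0
  have hχ : ∀ r, χ ⬝ᵥ edgeVec (d r) = χ (d r).fst - χ (d r).snd := by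
    intro r
    rw [edgeVec, dotProduct_sub, dotProduct_single, dotProduct_single, mul_one, mul_one]
  have h0 := congrArg (χ ⬝ᵥ ·) hc
  simp only [dotProduct_sum, dotProduct_smul, hχ, dotProduct_zero] at h0
  rw [Finset.sum_eq_single p] at h0
  · simp [χ, hnr, hp] at h0
  · intro r _ hrp
    by_cases hr : c r = 0
    · rw [hr, zero_smul]
    have hadj : H.Adj (d r).fst (d r).snd :=
      (indexedGraph_adj_iff _ _ _ _).2 ⟨r, by simp [hrp, hr], rfl⟩
    have : H.Reachable (d p).fst (d r).fst ↔ H.Reachable (d p).fst (d r).snd :=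
      ⟨fun h => h.trans hadj.reachable, fun h => h.trans hadj.symm.reachable⟩
    simp only [χ, this, sub_self, smul_zero]
  · simp

theorem IsCyclicSystem.sum_eq_zero (hy : IsCyclicSystem G y) (d : κ → G.Dart) (c : κ → ℚ)
    (hc : ∑ r, c r • edgeVec (d r) = 0) :
    ∑ r, c r • ∏ q ∈ Finset.univ.erase r, y (d q).fst (d q).snd = 0 := by
  induction h : (Finset.univ.filter fun r => c r ≠ 0).card using Nat.strong_induction_on
    generalizing c with
  | _ m ih =>
    by_cases h0 : ∀ r, c r = 0
    · simp [h0]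
    push Not at h0
    obtain ⟨p, hp⟩ := h0
    obtain ⟨s, hsp, hs, hsv, hsy⟩ := hy.exists_circuit d (Finset.notMem_erase p _)
      (reachable_of_dependence d hc hp)
    rw [Finset.insert_erase (by simp [hp])] at hs
    -- Subtracting this multiple of the circuit cancels the coefficient at `p` and creates no new
    -- support.
    have hlt : (Finset.univ.filter fun r => c r - c p / s p * s r ≠ 0).card < m := by
      rw [← h]
      refine Finset.card_lt_card ((Finset.ssubset_iff_of_subset ?_).2 ⟨p, by simp [hp], ?_⟩)
      · intro r hr
        rw [Finset.mem_filter] at hr ⊢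
        refine ⟨Finset.mem_univ _, fun hcr => hr.2 ?_⟩
        have : s r = 0 := by
          by_contra hsr
          exact (Finset.mem_filter.1 (hs r hsr)).2 hcr
        rw [hcr, this, mul_zero, sub_zero]
      · simp [div_mul_cancel₀ _ hsp]
    have := ih _ hlt (fun r => c r - c p / s p * s r) (by
      simp only [sub_smul, mul_smul, Finset.sum_sub_distrib, ← Finset.smul_sum, hc, hsv,
        smul_zero, sub_zero]) rfl
    simpa only [sub_smul, mul_smul, Finset.sum_sub_distrib, ← Finset.smul_sum, hsy, smul_zero,
      sub_zero] using this

theorem IsCyclicSystem.prod_eq_zero_of_edge_eq (hy : IsCyclicSystem G y) (d : κ → G.Dart)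
    {p q : κ} (hpq : p ≠ q) (h : (d p).edge = (d q).edge) :
    ∏ r, y (d r).fst (d r).snd = 0 := by
  obtain ⟨σ, -, hσ, -⟩ := exists_sign_of_edge_eq hy.neg (d p)
    (a := (d q).fst) (b := (d q).snd) h
  rw [← Finset.mul_prod_erase _ _ (Finset.mem_univ p),
    ← Finset.mul_prod_erase _ _ (Finset.mem_erase.2 ⟨hpq.symm, Finset.mem_univ q⟩), ← mul_assoc,
    hσ, mul_smul_comm, hy.mul_self, smul_zero, zero_mul]

theorem IsCyclicSystem.prod_eq_zero_of_cycle (hy : IsCyclicSystem G y) {k : ℕ}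
    (d : Fin k → G.Dart) (h : ¬ (suppGraph d).IsAcyclic) : ∏ r, y (d r).fst (d r).snd = 0 := by
  rw [SimpleGraph.isAcyclic_iff_forall_isBridge] at h
  push Not at h
  obtain ⟨e, he, hb⟩ := h
  obtain ⟨p, rfl⟩ : ∃ p, (d p).edge = e := by
    rw [suppGraph, SimpleGraph.edgeSet_fromEdgeSet] at he
    exact he.1
  have hb' : ¬ (suppGraph d).IsBridge s((d p).fst, (d p).snd) := hb
  rw [SimpleGraph.isBridge_iff, not_not] at hb'
  have hle : (suppGraph d).deleteEdges {s((d p).fst, (d p).snd)} ≤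
      indexedGraph d (Finset.univ.erase p) := by
    intro a b hab
    rw [SimpleGraph.deleteEdges_adj, suppGraph, SimpleGraph.fromEdgeSet_adj] at hab
    obtain ⟨⟨⟨q, hq⟩, -⟩, hne⟩ := hab
    refine (indexedGraph_adj_iff _ _ _ _).2 ⟨q, Finset.mem_erase.2 ⟨?_, Finset.mem_univ _⟩, hq⟩
    rintro rfl
    exact hne hq.symm
  obtain ⟨s, hsp, -, -, hsy⟩ := hy.exists_circuit d (Finset.notMem_erase p _) (hb'.mono hle)
  -- A non-bridge `d p` lies on a circuit; after multiplication by its variable, every term but that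
  -- of `p` contains a square.
  have h0 := congrArg (y (d p).fst (d p).snd * ·) hsy
  simp only [Finset.mul_sum, mul_zero, mul_smul_comm] at h0
  rw [Finset.sum_eq_single p, Finset.mul_prod_erase _ (fun r => y (d r).fst (d r).snd) (Finset.mem_univ p)] at h0
  · exact (smul_eq_zero.1 h0).resolve_left hsp
  · intro r _ hrp
    rw [← Finset.mul_prod_erase _ _ (Finset.mem_erase.2 ⟨hrp.symm, Finset.mem_univ p⟩),
      ← mul_assoc, hy.mul_self, zero_mul, smul_zero]
  · simp

/-- The homomorphism from the Orlik-Terao algebra given by a cyclic system. -/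
theorem IsCyclicSystem.exists_algHom (hy : IsCyclicSystem G y) :
    ∃ ψ : OTAlg G →ₐ[ℚ] C, ∀ (i j : Fin n) (h : G.Adj i j), ψ (otU G i j h) = y i j := by
  refine ⟨Ideal.Quotient.liftₐ _
    (MvPolynomial.aeval fun d : G.Dart => y d.fst d.snd) ?_, ?_⟩
  · intro f hf
    refine (Ideal.span_le (I := RingHom.ker (MvPolynomial.aeval (R := ℚ)
      fun d : G.Dart => y d.fst d.snd))).2 ?_ hf
    rintro _ (d | ⟨k, d, p, q, hpq, h⟩ | ⟨k, d, h⟩ | ⟨k, d, c, h⟩)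
    · rw [SetLike.mem_coe, RingHom.mem_ker, map_add, MvPolynomial.aeval_X, MvPolynomial.aeval_X,
        hy.neg]
      exact neg_add_cancel _
    · rw [SetLike.mem_coe, RingHom.mem_ker, map_prod]
      simpa using hy.prod_eq_zero_of_edge_eq d hpq h
    · rw [SetLike.mem_coe, RingHom.mem_ker, map_prod]
      simpa using hy.prod_eq_zero_of_cycle d h
    · rw [SetLike.mem_coe, RingHom.mem_ker, map_sum]
      simpa [map_prod] using hy.sum_eq_zero d c h
  · intro i j h
    exact (Ideal.Quotient.lift_mk _ _ _).trans (MvPolynomial.aeval_X _ _)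

end CircuitRelations

/-! ### Squarefree monomials in the Orlik–Terao algebra. -/

section OrlikTerao

variable {n : ℕ} {G : SimpleGraph (Fin n)}

/-- The squarefree monomial of the Orlik-Terao algebra with a given set of oriented edges. -/
noncomputable def otMonomial (G : SimpleGraph (Fin n)) (S : Finset G.Dart) : OTAlg G :=
  ∏ d ∈ S, otU G d.fst d.snd d.adj

theorem ot_mk_eq_zero {f : MvPolynomial G.Dart ℚ} (h : OTRelator G f) :
    Ideal.Quotient.mkₐ ℚ (Ideal.span {f | OTRelator G f}) f = 0 :=
  Ideal.Quotient.eq_zero_iff_mem.2 (Ideal.subset_span h)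

theorem otU_mul_self (d : G.Dart) :
    otU G d.fst d.snd d.adj * otU G d.fst d.snd d.adj = 0 := by
  have := ot_mk_eq_zero (OTRelator.repeated (G := G) 2 (fun _ => d) 0 1 (by decide) rfl)
  rw [Fin.prod_univ_two, map_mul] at this
  exact this

theorem otMonomial_rel (T : Finset G.Dart) (c : G.Dart → ℚ)
    (hc : ∑ t ∈ T, c t • edgeVec t = 0) : ∑ t ∈ T, c t • otMonomial G (T.erase t) = 0 := by
  obtain ⟨k, e, rfl⟩ : ∃ (k : ℕ) (e : Fin k ↪ G.Dart), Finset.univ.map e = T := by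
    refine ⟨T.card, T.equivFin.symm.toEmbedding.trans (Function.Embedding.subtype _), ?_⟩
    rw [← Finset.map_map, Finset.map_univ_equiv, Finset.univ_eq_attach, Finset.attach_map_val]
  rw [Finset.sum_map] at hc ⊢
  have := ot_mk_eq_zero (OTRelator.dependence k e (fun p => c (e p)) hc)
  rw [map_sum] at this
  rw [← this]
  refine Finset.sum_congr rfl fun p _ => ?_
  rw [map_smul, map_prod, ← Finset.map_erase, otMonomial, Finset.prod_map]
  rfl

theorem isOrlikTerao_otMonomial (A : Finset G.Dart) :
    IsOrlikTerao ℚ (edgeVec (G := G)) A (otMonomial G) where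
  dep S _ hS := by
    rw [linearIndepOn_finset_iff] at hS
    push Not at hS
    obtain ⟨c, hc, t, ht, hct⟩ := hS
    -- Multiplying by the variable of `t` leaves only `c t` times the monomial of `S`; the other
    -- terms contain a square.
    have h0 := congrArg (otU G t.fst t.snd t.adj * ·) (otMonomial_rel S c hc)
    simp only [Finset.mul_sum, mul_zero, mul_smul_comm] at h0
    rw [Finset.sum_eq_single t, otMonomial,
      Finset.mul_prod_erase _ (fun d : G.Dart => otU G d.fst d.snd d.adj) ht] at h0
    · exact (smul_eq_zero.1 h0).resolve_left hct
    · intro r hr hrt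
      rw [otMonomial, ← Finset.mul_prod_erase _ _ (Finset.mem_erase.2 ⟨hrt.symm, ht⟩), ← mul_assoc,
        otU_mul_self, zero_mul, smul_zero]
    · exact fun h => absurd ht h
  rel T _ c hc := otMonomial_rel T c hc

theorem exists_eq_sum_otMonomial [Fintype G.Dart] (x : OTAlg G) :
    ∃ a : Finset G.Dart → ℚ, ∑ S, a S • otMonomial G S = x := by
  rw [← Submodule.mem_span_range_iff_exists_fun]
  obtain ⟨f, rfl⟩ := Ideal.Quotient.mkₐ_surjective ℚ _ x
  induction f using MvPolynomial.induction_on with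
  | C r =>
    have : Ideal.Quotient.mkₐ ℚ (Ideal.span {f | OTRelator G f}) (MvPolynomial.C r) =
        r • otMonomial G ∅ := by
      rw [otMonomial, Finset.prod_empty, ← Algebra.algebraMap_eq_smul_one]
      exact AlgHom.commutes _ r
    rw [this]
    exact Submodule.smul_mem _ _ (Submodule.subset_span ⟨∅, rfl⟩)
  | add f g hf hg =>
    rw [map_add]
    exact add_mem hf hg
  | mul_X f d hf =>
    rw [map_mul]
    change _ * otU G d.fst d.snd d.adj ∈ _
    generalize Ideal.Quotient.mkₐ ℚ (Ideal.span {f | OTRelator G f}) f = x at hf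
    induction hf using Submodule.span_induction with
    | mem x hx =>
      obtain ⟨S, rfl⟩ := hx
      by_cases hd : d ∈ S
      · rw [otMonomial, ← Finset.mul_prod_erase _ _ hd, mul_right_comm, otU_mul_self, zero_mul]
        exact zero_mem _
      · rw [otMonomial, mul_comm,
          ← Finset.prod_insert (f := fun d : G.Dart => otU G d.fst d.snd d.adj) hd]
        exact Submodule.subset_span ⟨insert d S, rfl⟩
    | zero => rw [zero_mul]; exact zero_mem _
    | add x y _ _ hx hy => rw [add_mul]; exact add_mem hx hy
    | smul a x _ hx => rw [smul_mul_assoc]; exact Submodule.smul_mem _ _ hx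

end OrlikTerao

/-! ### The two algebras compared. -/

section FominKirillov

variable {n : ℕ} {G : SimpleGraph (Fin n)}

noncomputable instance fkAbCommRing (G : SimpleGraph (Fin n)) : CommRing (FKAb G) :=
  { Algebra.semiringToRing ℚ (A := FKAb G) with mul_comm := fkAb_mul_comm G }

/-- The generators of the Fomin-Kirillov algebra, extended by zero to the diagonal. -/
noncomputable def fkGen {n : ℕ} (i j : Fin n) : FKAlg n := if h : i ≠ j then fkX i j h else 0

theorem fkGen_of_ne {i j : Fin n} (h : i ≠ j) : fkGen i j = fkX i j h := dif_pos h

theorem fkGen_self (i : Fin n) : fkGen i i = 0 := dif_neg (by simp)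

theorem fkX_neg {i j : Fin n} (h : i ≠ j) : fkX i j h = -fkX j i h.symm := by
  have := RingQuot.mkAlgHom_rel ℚ (FKRel.antisymm i j h)
  simpa [fkX] using this

theorem fkX_sq {i j : Fin n} (h : i ≠ j) : fkX i j h * fkX i j h = 0 := by
  have := RingQuot.mkAlgHom_rel ℚ (FKRel.sq i j h)
  rw [map_zero, sq, map_mul] at this
  exact this

theorem fkGen_neg (i j : Fin n) : fkGen i j = -fkGen j i := by
  by_cases h : i = j
  · subst h; rw [fkGen_self, neg_zero]
  · rw [fkGen_of_ne h, fkGen_of_ne (Ne.symm h), fkX_neg]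

theorem fkGen_commute (a b c d : Fin n) (hab : a ≠ b) (hcd : c ≠ d) (hac : a ≠ c) (had : a ≠ d)
    (hbc : b ≠ c) (hbd : b ≠ d) : Commute (fkGen a b) (fkGen c d) := by
  have := RingQuot.mkAlgHom_rel ℚ (FKRel.comm a b c d hab hcd hac had hbc hbd)
  rw [map_mul, map_mul] at this
  rw [fkGen_of_ne hab, fkGen_of_ne hcd]
  exact this

theorem fkGen_triangle (a b c : Fin n) (hab : a ≠ b) (hbc : b ≠ c) (hca : c ≠ a) :
    fkGen a b * fkGen b c + fkGen b c * fkGen c a + fkGen c a * fkGen a b = 0 := by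
  have := RingQuot.mkAlgHom_rel ℚ (FKRel.triangle a b c hab hbc hca)
  rw [map_zero, map_add, map_add, map_mul, map_mul, map_mul] at this
  rw [fkGen_of_ne hab, fkGen_of_ne hbc, fkGen_of_ne hca]
  exact this

open Classical in
/-- The generators of the algebra of `G`, extended by zero to all pairs of vertices. -/
noncomputable def subGen (G : SimpleGraph (Fin n)) (i j : Fin n) : FKSub G :=
  if h : G.Adj i j then edgeX G i j h else 0

theorem subGen_of_adj {i j : Fin n} (h : G.Adj i j) : subGen G i j = edgeX G i j h := dif_pos h

theorem subGen_of_not_adj {i j : Fin n} (h : ¬ G.Adj i j) : subGen G i j = 0 := dif_neg h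

theorem val_subGen {i j : Fin n} (h : G.Adj i j) : (FKSub G).val (subGen G i j) = fkGen i j := by
  rw [subGen_of_adj h, fkGen_of_ne h.ne]
  rfl

theorem subGen_neg (i j : Fin n) : subGen G i j = (-1 : ℚ) • subGen G j i := by
  by_cases h : G.Adj i j
  · apply Subtype.ext
    rw [subGen_of_adj h, subGen_of_adj h.symm]
    exact (fkX_neg h.ne).trans (neg_one_smul ℚ _).symm
  · rw [subGen_of_not_adj h, subGen_of_not_adj fun h' => h h'.symm, smul_zero]

theorem subGen_mul_self (i j : Fin n) : subGen G i j * subGen G i j = 0 := by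
  by_cases h : G.Adj i j
  · apply Subtype.ext
    rw [subGen_of_adj h]
    exact fkX_sq h.ne
  · rw [subGen_of_not_adj h, mul_zero]

/-- The induction behind the cyclic relation uses chords that need not be edges of `G`, so it takes
place in `FKAlg n`; the final relation involves only edges and is pulled back along the inclusion.
-/
theorem subGen_cyclic {H : SimpleGraph (Fin n)} (hH : H ≤ G) {a b : Fin n} (w : H.Walk a b)
    (hw : w.IsPath) (hab : G.Adj a b) :
    walkProd (subGen G) w = walkRot (subGen G) w (subGen G a b) := by
  have hval : ∀ i j, H.Adj i j → ((FKSub G).val : FKSub G →+* FKAlg n) (subGen G i j) = fkGen i j :=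
    fun i j h => val_subGen (hH h)
  have : Function.Injective ((FKSub G).val : FKSub G →+* FKAlg n) := Subtype.val_injective
  apply this
  rw [map_walkProd _ hval, map_walkRot _ hval,
    walkProd_eq_walkRot fkGen fkGen_neg fkGen_commute fkGen_self fkGen_triangle w hw hab.ne]
  exact congrArg _ (val_subGen hab).symm

theorem isCyclicSystem_abProj (G : SimpleGraph (Fin n)) :
    IsCyclicSystem G fun i j => abProj G (subGen G i j) where
  neg a b := by
    rw [subGen_neg, map_smul, neg_one_smul]
  mul_self a b := by
    rw [← map_mul, subGen_mul_self, map_zero]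
  cyclic H hH a b w hw hab := by
    have hproj : ∀ i j, H.Adj i j →
        (abProj G : FKSub G →+* FKAb G) (subGen G i j) = abProj G (subGen G i j) := fun _ _ _ => rfl
    have := congrArg (abProj G : FKSub G →+* FKAb G) (subGen_cyclic hH w hw hab)
    rw [map_walkProd _ hproj, map_walkRot _ hproj] at this
    exact this

/-- The vector `e_i - e_j` of a pair of distinct vertices. -/
def pairVec {n : ℕ} (p : OrdPair n) : Fin n → ℚ := Pi.single p.1.1 1 - Pi.single p.1.2 1

theorem pairVec_ne_zero (p : OrdPair n) : pairVec p ≠ 0 := by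
  intro h
  have := congrFun h p.1.1
  simp [pairVec, p.2] at this

/-- The action of the Fomin-Kirillov algebra on the functions satisfying the Orlik-Terao
relations of the complete graph. -/
theorem exists_fk_action (n : ℕ) (M : Type) [AddCommGroup M] [Module ℚ M] :
    ∃ ρ : FKAlg n →ₐ[ℚ] Module.End ℚ (orlikTeraoFun ℚ (pairVec (n := n)) M),
      ∀ (i j : Fin n) (h : i ≠ j), ρ (fkX i j h) = otAct ℚ pairVec M ⟨(i, j), h⟩ := by
  have hX : ∀ (i j : Fin n) (h : i ≠ j), FreeAlgebra.lift ℚ (otAct ℚ (pairVec (n := n)) M)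
      (freeX i j h) = otAct ℚ pairVec M ⟨(i, j), h⟩ := fun i j h => FreeAlgebra.lift_ι_apply _ _
  refine ⟨RingQuot.liftAlgHom ℚ ⟨FreeAlgebra.lift ℚ (otAct ℚ pairVec M), ?_⟩, fun i j h => ?_⟩
  · rintro _ _ (⟨i, j, h⟩ | ⟨i, j, h⟩ | ⟨i, j, k, l, hij, hkl⟩ | ⟨i, j, k, hij, hjk, hki⟩)
    · have e : -freeX j i h.symm = (-1 : ℚ) • freeX j i h.symm := (neg_one_smul ℚ _).symm
      rw [e, map_smul, hX, hX]
      have h0 := otAct_add_eq_zero (K := ℚ) (M := M) (v := pairVec (n := n)) (d := ⟨(i, j), h⟩)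
        (e := ⟨(j, i), h.symm⟩) (fun he => h (congrArg (fun p : OrdPair n => p.1.1) he))
        (by simp [pairVec])
      ext F S
      have := congrFun (congrArg Subtype.val (LinearMap.congr_fun h0 F)) S
      exact (eq_neg_of_add_eq_zero_left this).trans (neg_one_smul ℚ _).symm
    · rw [sq, map_mul, map_zero, hX, otAct_mul_self]
    · rw [map_mul, map_mul, hX, hX, (otAct_commute _ _ _).eq]
    · rw [map_add, map_add, map_mul, map_mul, map_mul, map_zero, hX, hX, hX]
      refine otAct_triangle ?_ ?_ ?_ ?_
      · exact fun he => hij (congrArg (fun p : OrdPair n => p.1.1) he)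
      · exact fun he => hjk (congrArg (fun p : OrdPair n => p.1.1) he)
      · exact fun he => hki (congrArg (fun p : OrdPair n => p.1.1) he)
      · simp [pairVec]
  · rw [fkX, RingQuot.liftAlgHom_mkAlgHom_apply, hX]

/-- An edge of `G` as a pair of distinct vertices. -/
def dartPair (G : SimpleGraph (Fin n)) : G.Dart ↪ OrdPair n where
  toFun d := ⟨d.toProd, d.adj.ne⟩
  inj' _ _ h := SimpleGraph.Dart.ext _ _ (congrArg Subtype.val h)

/-- The action on functions of the complete graph is restricted, since maps out of the subalgebra
are available only from `FKAlg n`. It descends because the operators commute. -/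
theorem exists_fkAb_action (G : SimpleGraph (Fin n)) (M : Type) [AddCommGroup M] [Module ℚ M] :
    ∃ τ : FKAb G →ₐ[ℚ] Module.End ℚ (orlikTeraoFun ℚ (pairVec (n := n)) M),
      ∀ d : G.Dart, τ (abProj G (edgeX G d.fst d.snd d.adj)) =
        otAct ℚ pairVec M (dartPair G d) := by
  obtain ⟨ρ, hρ⟩ := exists_fk_action n M
  have hX : ∀ (i j : Fin n) (h : G.Adj i j), (ρ.comp (FKSub G).val) (edgeX G i j h) =
      otAct ℚ pairVec M ⟨(i, j), h.ne⟩ := fun i j h => hρ i j h.ne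
  refine ⟨RingQuot.liftAlgHom ℚ ⟨ρ.comp (FKSub G).val, ?_⟩, fun d => ?_⟩
  · rintro _ _ ⟨i, j, k, hij, hik⟩
    rw [map_mul, map_mul, hX, hX, (otAct_commute _ _ _).eq]
  · rw [abProj, RingQuot.liftAlgHom_mkAlgHom_apply, hX]
    rfl

theorem linearIndepOn_map_dartPair (S : Finset G.Dart) :
    LinearIndepOn ℚ (pairVec (n := n)) (S.map (dartPair G) : Set (OrdPair n)) ↔
      LinearIndepOn ℚ (edgeVec (G := G)) (S : Set G.Dart) := by
  rw [Finset.coe_map]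
  exact ⟨fun h => h.comp_of_image (dartPair G).injective.injOn,
    fun h => LinearIndepOn.image_of_comp _ _ h⟩

/-- Passing from `G` to the complete graph costs a fixed nonzero factor, which cancels from linear
relations. -/
theorem complProd_map_dartPair [Fintype G.Dart] (S : Finset G.Dart) :
    complProd ℚ (pairVec (n := n)) Finset.univ (S.map (dartPair G)) =
      (∏ p ∈ Finset.univ \ Finset.univ.map (dartPair G),
        SymmetricAlgebra.ι ℚ (Fin n → ℚ) (pairVec p)) *
      complProd ℚ (edgeVec (G := G)) Finset.univ S := by
  by_cases h : LinearIndepOn ℚ (edgeVec (G := G)) (S : Set G.Dart)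
  · rw [complProd_of_indep h, complProd_of_indep ((linearIndepOn_map_dartPair S).2 h)]
    have : ∏ t ∈ Finset.univ \ S, SymmetricAlgebra.ι ℚ (Fin n → ℚ) (edgeVec t) =
        ∏ p ∈ Finset.univ.map (dartPair G) \ S.map (dartPair G),
          SymmetricAlgebra.ι ℚ (Fin n → ℚ) (pairVec p) := by
      rw [← Finset.map_sdiff, Finset.prod_map]
      rfl
    rw [this, ← Finset.prod_union]
    · congr 1
      ext p
      have := @Finset.map_subset_map _ _ (dartPair G) S Finset.univ |>.2 (Finset.subset_univ S)
      have := @this p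
      simp only [Finset.mem_sdiff, Finset.mem_union, Finset.mem_univ, true_and]
      tauto
    · exact Finset.sdiff_disjoint.mono_right Finset.sdiff_subset
  · rw [complProd_of_dep h, complProd_of_dep (mt (linearIndepOn_map_dartPair S).1 h), mul_zero]

theorem otAlg_hom_surjective {ψ : OTAlg G →ₐ[ℚ] FKAb G}
    (hψ : ∀ (i j : Fin n) (h : G.Adj i j), ψ (otU G i j h) = abProj G (edgeX G i j h)) :
    Function.Surjective ψ := by
  intro x
  obtain ⟨⟨x, hx⟩, rfl⟩ := RingQuot.mkAlgHom_surjective ℚ (AbRel G) x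
  change abProj G ⟨x, hx⟩ ∈ ψ.range
  induction hx using Algebra.adjoin_induction with
  | mem x hx =>
    obtain ⟨d, rfl⟩ := hx
    exact ⟨_, hψ d.fst d.snd d.adj⟩
  | algebraMap r => exact (abProj G).commutes r ▸ ψ.range.algebraMap_mem r
  | add x y hx hy h1 h2 =>
    have e : (⟨x + y, add_mem hx hy⟩ : FKSub G) = ⟨x, hx⟩ + ⟨y, hy⟩ := rfl
    rw [e, map_add]
    exact add_mem h1 h2
  | mul x y hx hy h1 h2 =>
    have e : (⟨x * y, mul_mem hx hy⟩ : FKSub G) = ⟨x, hx⟩ * ⟨y, hy⟩ := rfl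
    rw [e, map_mul]
    exact mul_mem h1 h2

theorem otAlg_hom_injective {ψ : OTAlg G →ₐ[ℚ] FKAb G}
    (hψ : ∀ (i j : Fin n) (h : G.Adj i j), ψ (otU G i j h) = abProj G (edgeX G i j h)) :
    Function.Injective ψ := by
  classical
  rw [injective_iff_map_eq_zero]
  intro x hx
  obtain ⟨a, rfl⟩ := exists_eq_sum_otMonomial x
  obtain ⟨τ, hτ⟩ := exists_fkAb_action G (SymmetricAlgebra ℚ (Fin n → ℚ))
  -- The monomial of `S` acts as translation by `S`; with `T = ∅` this reads off the value of `F` at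
  -- the image of `S`.
  have hact : ∀ (S : Finset G.Dart)
      (F : orlikTeraoFun ℚ (pairVec (n := n)) (SymmetricAlgebra ℚ (Fin n → ℚ)))
      (T : Finset (OrdPair n)), Disjoint (S.map (dartPair G)) T →
      (τ (ψ (otMonomial G S)) F).1 T =
        F.1 (S.map (dartPair G) ∪ T) := by
    intro S F
    induction S using Finset.induction with
    | empty => intro T _; simp [otMonomial]
    | insert d S hd ih =>
      intro T hT
      rw [Finset.map_insert, Finset.disjoint_insert_left] at hT
      rw [otMonomial, Finset.prod_insert hd, map_mul, map_mul, hψ, hτ, Module.End.mul_apply,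
        otAct_apply, if_neg hT.1]
      refine (ih _ ?_).trans ?_
      · rw [Finset.disjoint_insert_right]
        exact ⟨by simpa using hd, hT.2⟩
      · rw [Finset.map_insert, Finset.union_insert, Finset.insert_union]
  have h0 := congrArg (fun z => (τ z ⟨complProd ℚ (pairVec (n := n)) Finset.univ,
    isOrlikTerao_complProd _ _⟩).1 ∅) hx
  have h1 : ∑ S, a S • complProd ℚ (pairVec (n := n)) Finset.univ (S.map (dartPair G)) = 0 := by
    rw [map_zero] at h0
    refine Eq.trans ?_ h0
    simp only [map_sum, map_smul, LinearMap.sum_apply, LinearMap.smul_apply]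
    rw [Submodule.coe_sum, Finset.sum_apply]
    refine Finset.sum_congr rfl fun S _ => ?_
    rw [Submodule.coe_smul, Pi.smul_apply, hact S _ ∅ (Finset.disjoint_empty_right _),
      Finset.union_empty]
  simp only [complProd_map_dartPair, ← mul_smul_comm] at h1
  rw [← Finset.mul_sum] at h1
  have h2 := (mul_eq_zero.1 h1).resolve_left (Finset.prod_ne_zero_iff.2 fun p _ =>
    symmetricAlgebra_ι_ne_zero (pairVec_ne_zero p))
  rw [← Finset.powerset_univ] at h2 ⊢
  exact (isOrlikTerao_otMonomial Finset.univ).sum_eq_zero h2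

end FominKirillov

theorem theorem2p6 (n : ℕ) (G : SimpleGraph (Fin n)) :
    ∃ φ : FKAb G ≃ₐ[ℚ] OTAlg G,
      ∀ (i j : Fin n) (h : G.Adj i j), φ (abProj G (edgeX G i j h)) = otU G i j h := by
  obtain ⟨ψ, hψ⟩ := (isCyclicSystem_abProj G).exists_algHom
  have hψ' : ∀ (i j : Fin n) (h : G.Adj i j), ψ (otU G i j h) = abProj G (edgeX G i j h) :=
    fun i j h => by rw [hψ, subGen_of_adj h]
  let e := AlgEquiv.ofBijective ψ ⟨otAlg_hom_injective hψ', otAlg_hom_surjective hψ'⟩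
  exact ⟨e.symm, fun i j h => e.symm_apply_eq.2 (hψ' i j h).symm⟩
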